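/- All graphs are finite and simple. A graph $G$ is \emph{$4$-connected} if $|V(G)|>4$ and $G\setminus S$ is connected for every $S\subseteq V(G)$ with $|S|<4$. For graphs $G$ and $H$, an \emph{$H$-model} of $G$ is a map $f:V(G)\to V(H)$ such that (1) for each $i\in V(H)$ the subgraph of $G$ induced on $\{v\in V(G): f(v)=i\}$ is nonempty and connected, and (2) for each edge $ij\in E(H)$ there is an edge $uv\in E(G)$ with $f(u)=i$ and $f(v)=j$. The \emph{reconfiguration graph} of $G$ and $H$ has the $H$-models of $G$ as its nodes, two models being adjacent if they differ in the label of exactly one vertex of $G$. Let $\mathrm{host}(H)$ be the set of graphs $G$ that have at least one $H$-model and for which the reconfiguration graph of $G$ and $H$ is connected. \textbf{Lemma.} Suppose $G$ is a $4$-connected graph with $G\in\mathrm{host}(K_4)$, let $x,y$ be two distinct vertices of $G$, and let $G'$ be formed from $G$ by adding the edge $xy$. Then $G'\in\mathrm{host}(K_4)$. -/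

import Mathlib

namespace MinorReconfiguration

/-- A graph on a finite vertex set is `k`-connected if it has more than `k` vertices and deleting
any set of fewer than `k` vertices leaves a connected graph. -/
def IsKConnected {V : Type*} (G : SimpleGraph V) (k : ℕ) : Prop :=
  k < Nat.card V ∧
    ∀ S : Finset V, S.card < k → (G.induce {v : V | v ∉ S}).Connected

/-- `f : V(G) → V(H)` is an `H`-model of `G`: every branch set is nonempty and connected
(`SimpleGraph.Connected` includes nonemptiness), and every edge `ij` of `H` is realised by an edge
of `G` between the branch sets of `i` and `j`. -/
structure IsModel {V W : Type*} (G : SimpleGraph V) (H : SimpleGraph W) (f : V → W) : Prop where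
  branch_connected : ∀ i : W, (G.induce {v : V | f v = i}).Connected
  exists_edge : ∀ i j : W, H.Adj i j → ∃ u v : V, f u = i ∧ f v = j ∧ G.Adj u v

/-- The reconfiguration graph of host `G` and target `H`: its nodes are the `H`-models of `G`, and
two models are adjacent if they differ in the label of exactly one vertex of `G`. -/
def reconfigurationGraph {V W : Type*} (G : SimpleGraph V) (H : SimpleGraph W) :
    SimpleGraph {f : V → W // IsModel G H f} where
  Adj f g := ∃! v : V, f.1 v ≠ g.1 v
  symm := ⟨fun f g h => by simpa only [ne_comm] using h⟩
  loopless := ⟨fun f h => by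
    obtain ⟨v, hv, -⟩ := h
    exact hv rfl⟩

/-- `host H V` is the set of graphs `G` on the vertex type `V` whose reconfiguration graph for the
target `H` is connected; in particular it has a node, that is, `H` is a minor of `G`. -/
def host {W : Type*} (H : SimpleGraph W) (V : Type*) : Set (SimpleGraph V) :=
  {G | (reconfigurationGraph G H).Connected}

end MinorReconfiguration

/-!
Let `H = G + xy`. Every `K₄`-model of `G` is one of `H`, and moves between models of `G` are moves
between models of `H`. As the reconfiguration graph of `G` is connected, it is enough to show that
every `K₄`-model `f` of `H` can be moved to some `K₄`-model of `G` (`reachesModel`).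

All moves are found with `exists_noncut_vertex`: if no part of a rooted connected set `D` can be cut
off from `D ∪ T` by a single vertex of `D`, then some vertex of `D` other than the root has a
neighbour in `T` and is not a cut vertex of `D`. Its hypothesis comes from 4-connectivity, which
leaves room for two further vertices besides the cutting one.

* `f x ≠ f y` (`reachesModel_of_label_ne`). If no edge of `G` joins the branch sets `A` of `x` and
  `B` of `y`, shrink `B` to `{y}`, moving its vertices to the other two branch sets `C` and `D`; the
  edge `xy` keeps `A` and `B` adjacent. Next shrink `C` to a single neighbour `z` of `y`, moving its
  vertices to `A` and `D`. Finally let `A` absorb vertices of `D`, never the chosen neighbour of `z`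
  in `D`. While `A` contains no `G`-neighbour of `y`, all neighbours of `y` but `z` lie in `D`, so
  `D` remains adjacent to `y`, and 4-connectivity allows a further step because only `y`, `z` and
  one cut vertex have to be avoided. Thus `A` must meet a neighbour of `y`, and then `xy` is no
  longer needed.
* `f x = f y` (`reachesModel_of_bridge`). If `xy` is needed, it is a bridge between two parts
  `A₁ ∋ x` and `A₂ ∋ y` of a branch set. One of them, say `A₁`, has neighbours in at least two of
  the three other branch sets. Then the vertices of `A₂` can be moved out one by one, `y` last, and
  `x` and `y` end up with different labels.
-/

namespace MinorReconfiguration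

open SimpleGraph

variable {V : Type*}

/-! ### Connected vertex sets -/

/-- A vertex set induces a connected subgraph iff it is nonempty and no proper nonempty part of it
is closed under adjacency. -/
theorem connected_induce_iff_closed (G : SimpleGraph V) (D : Set V) :
    (G.induce D).Connected ↔ D.Nonempty ∧ ∀ S ⊆ D, S.Nonempty →
      (∀ s ∈ S, ∀ t ∈ D, G.Adj s t → t ∈ S) → D ⊆ S := by
  constructor
  · intro h
    obtain ⟨d⟩ := h.nonempty
    refine ⟨⟨d.1, d.2⟩, fun S hS ⟨s, hs⟩ hcl t ht => ?_⟩
    obtain ⟨p⟩ := h.preconnected ⟨s, hS hs⟩ ⟨t, ht⟩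
    have key : ∀ u w : D, (G.induce D).Walk u w → u.1 ∈ S → w.1 ∈ S := by
      intro u w p
      induction p with
      | nil => exact id
      | cons e _ ih => exact fun hu => ih (hcl _ hu _ (Subtype.coe_prop _) e)
    exact key _ _ p hs
  · rintro ⟨⟨d, hd⟩, h⟩
    rw [connected_iff_exists_forall_reachable]
    refine ⟨⟨d, hd⟩, fun w => ?_⟩
    obtain ⟨hw, hr⟩ := h {u | ∃ hu : u ∈ D, (G.induce D).Reachable ⟨d, hd⟩ ⟨u, hu⟩}
      (fun u hu => hu.1) ⟨d, hd, Reachable.refl _⟩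
      (fun s ⟨hs, hr⟩ t ht e => ⟨ht, hr.trans
        (Adj.reachable (show (G.induce D).Adj ⟨s, hs⟩ ⟨t, ht⟩ from e))⟩) w.2
    exact hr

/-- A connected set stays connected when a vertex adjacent to it is added. -/
theorem connected_induce_insert {G : SimpleGraph V} {D : Set V} (h : (G.induce D).Connected)
    {v w : V} (hw : w ∈ D) (e : G.Adj v w) : (G.induce (insert v D)).Connected := by
  rw [connected_induce_iff_closed] at h ⊢
  refine ⟨⟨v, Set.mem_insert _ _⟩, fun S hS ⟨s, hs⟩ hcl => ?_⟩
  have hwS : w ∈ S ∨ ∃ u ∈ S, u ∈ D := by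
    rcases hS hs with rfl | h'
    · exact Or.inl (hcl _ hs _ (Set.mem_insert_of_mem _ hw) e)
    · exact Or.inr ⟨s, hs, h'⟩
  have hne : (S ∩ D).Nonempty := by
    rcases hwS with h' | ⟨u, hu, hu'⟩
    · exact ⟨w, h', hw⟩
    · exact ⟨u, hu, hu'⟩
  have hD := h.2 (S ∩ D) Set.inter_subset_right hne
    (fun s hs t ht e => ⟨hcl s hs.1 t (Set.mem_insert_of_mem _ ht) e, ht⟩)
  exact Set.insert_subset (hcl w (hD hw).1 v (Set.mem_insert _ _) e.symm)
    (fun u hu => (hD hu).1)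

/-- Two connected sets joined by an edge have a connected union. -/
theorem connected_induce_union {G : SimpleGraph V} {D E : Set V} (hD : (G.induce D).Connected)
    (hE : (G.induce E).Connected) {v w : V} (hv : v ∈ D) (hw : w ∈ E) (e : G.Adj v w) :
    (G.induce (D ∪ E)).Connected := by
  rw [connected_induce_iff_closed] at hD hE ⊢
  refine ⟨⟨v, Or.inl hv⟩, fun S hS ⟨s, hs⟩ hcl => ?_⟩
  have h1 : (S ∩ D).Nonempty → D ⊆ S := fun hne =>
    (hD.2 (S ∩ D) Set.inter_subset_right hne
      (fun s hs t ht e => ⟨hcl s hs.1 t (Or.inl ht) e, ht⟩)).trans Set.inter_subset_left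
  have h2 : (S ∩ E).Nonempty → E ⊆ S := fun hne =>
    (hE.2 (S ∩ E) Set.inter_subset_right hne
      (fun s hs t ht e => ⟨hcl s hs.1 t (Or.inr ht) e, ht⟩)).trans Set.inter_subset_left
  rcases hS hs with h | h
  · have hDS := h1 ⟨s, hs, h⟩
    exact Set.union_subset hDS (h2 ⟨w, hcl v (hDS hv) w (Or.inr hw) e, hw⟩)
  · have hES := h2 ⟨s, hs, h⟩
    exact Set.union_subset (h1 ⟨v, hcl w (hES hw) v (Or.inl hv) e.symm, hv⟩) hES

/-- In a connected set with at least two elements every vertex has a neighbour. -/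
theorem exists_adj_of_connected_induce {G : SimpleGraph V} {D : Set V}
    (h : (G.induce D).Connected) {v u : V} (hv : v ∈ D) (hu : u ∈ D) (huv : u ≠ v) :
    ∃ w ∈ D, w ≠ v ∧ G.Adj v w := by
  rw [connected_induce_iff_closed] at h
  by_contra! hno
  have := h.2 {v} (Set.singleton_subset_iff.2 hv) ⟨v, rfl⟩
    (fun s hs t ht e => by
      rw [Set.mem_singleton_iff] at hs
      subst hs
      by_contra hne
      exact hno t ht hne e)
  exact huv (this hu)

/-- Let `D` be connected with a root `z`, and suppose that no single vertex `w` of `D` cuts a part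
of `D` off from the rest of `D ∪ T`. Then some vertex of `D` other than the root has a neighbour in
`T` and is not a cut vertex of `D`. -/
theorem exists_noncut_vertex [Finite V] {G : SimpleGraph V} {D T : Set V} {z : V}
    (hD : (G.induce D).Connected) (hz : z ∈ D) (hne : ∃ u ∈ D, u ≠ z)
    (hsep : ∀ S ⊆ D, S.Nonempty → ∀ w ∈ D, w ∉ S →
      ∃ s ∈ S, ∃ t, G.Adj s t ∧ t ∉ S ∧ t ≠ w ∧ (t ∈ D ∨ t ∈ T)) :
    ∃ v ∈ D, v ≠ z ∧ (G.induce (D \ {v})).Connected ∧ ∃ t ∈ T, G.Adj v t := by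
  -- Pieces `K` that avoid the root and are cut off from the rest of `D` by a vertex `v`.
  let P : Set (Set V) := {K | K ⊆ D ∧ K.Nonempty ∧ z ∉ K ∧ ∃ v ∈ D, v ∉ K ∧
    ∀ s ∈ K, ∀ t ∈ D, t ≠ v → G.Adj s t → t ∈ K}
  have hP : P.Nonempty := by
    obtain ⟨u, hu, huz⟩ := hne
    exact ⟨D \ {z}, Set.sdiff_subset, ⟨u, hu, huz⟩, fun h => h.2 rfl, z, hz, fun h => h.2 rfl,
      fun s _ t ht htz _ => ⟨ht, htz⟩⟩
  obtain ⟨K, hK⟩ := (Set.toFinite P).exists_minimal hP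
  obtain ⟨hKD, hKne, hzK, v, hvD, hvK, hcl⟩ := hK.prop
  obtain ⟨s, hs, t, hst, htK, htv, htDT⟩ := hsep K hKD hKne v hvD hvK
  have htT : t ∈ T := htDT.resolve_left fun h => htK (hcl s hs t h htv hst)
  have hsv : v ≠ s := fun h => hvK (h ▸ hs)
  refine ⟨s, hKD hs, fun h => hzK (h ▸ hs), ?_, t, htT, hst⟩
  have hD' := (connected_induce_iff_closed G D).1 hD
  -- A closed part of `D \ {s}` missing `v` would be a smaller piece.
  have key : ∀ S ⊆ D \ {s}, S.Nonempty → v ∉ S →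
      (∀ a ∈ S, ∀ b ∈ D \ {s}, G.Adj a b → b ∈ S) → False := by
    intro S hS hSne hvS hScl
    have hSK : S ⊆ K := by
      by_contra hnot
      have hdiff : (S \ K).Nonempty := by
        obtain ⟨a, ha, haK⟩ := Set.not_subset.1 hnot
        exact ⟨a, ha, haK⟩
      have hall := hD'.2 (S \ K) (fun a ha => (hS ha.1).1) hdiff (by
        intro a ha b hb hab
        have hbK : b ∉ K := fun hbK =>
          ha.2 (hcl b hbK a (hS ha.1).1 (fun h => hvS (h ▸ ha.1)) hab.symm)
        exact ⟨hScl a ha.1 b ⟨hb, fun h => hbK (h ▸ hs)⟩ hab, hbK⟩)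
      exact (hall (hKD hs)).2 hs
    have hSP : S ∈ P := ⟨fun a ha => (hS ha).1, hSne, fun h => hzK (hSK h), s, hKD hs,
      fun h => (hS h).2 rfl, fun a ha b hb hbs hab => hScl a ha b ⟨hb, hbs⟩ hab⟩
    exact (hS (hK.le_of_le hSP hSK hs)).2 rfl
  rw [connected_induce_iff_closed]
  refine ⟨⟨v, hvD, hsv⟩, fun S hS hSne hScl => ?_⟩
  by_cases hvS : v ∈ S
  · intro u hu
    by_contra huS
    exact key ((D \ {s}) \ S) Set.sdiff_subset ⟨u, hu, huS⟩ (fun h => h.2 hvS)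
      (fun a ha b hb hab => ⟨hb, fun hbS => ha.2 (hScl b hbS a ha.1 hab.symm)⟩)
  · exact (key S hS hSne hvS hScl).elim

/-- In a `k`-connected graph fewer than `k` vertices do not separate two vertices. -/
theorem IsKConnected.exists_adj {G : SimpleGraph V} {k : ℕ} (hG : IsKConnected G k)
    (N : Finset V) (hN : N.card < k) {S : Set V} (hSN : ∀ s ∈ S, s ∉ N) (hS : S.Nonempty)
    {x : V} (hxS : x ∉ S) (hxN : x ∉ N) :
    ∃ s ∈ S, ∃ t, G.Adj s t ∧ t ∉ S ∧ t ∉ N := by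
  by_contra! h
  exact hxS (((connected_induce_iff_closed G _).1 (hG.2 N hN)).2 S hSN hS
    (fun s hs t ht e => by
      by_contra htS
      exact ht (h s hs t e htS)) hxN)

/-! ### Models and moves -/

/-- A model stays a model when edges are added to the host. -/
theorem IsModel.mono {W : Type*} {G G' : SimpleGraph V} {H : SimpleGraph W} {f : V → W}
    (hf : IsModel G H f) (h : G ≤ G') : IsModel G' H f :=
  ⟨fun i => (hf.branch_connected i).mono fun _ _ e => h e, fun i j hij => by
    obtain ⟨u, v, hu, hv, e⟩ := hf.exists_edge i j hij
    exact ⟨u, v, hu, hv, h e⟩⟩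

/-- Relabelling `v` by `j` keeps a model of a complete graph a model, if `v` has a neighbour
labelled `j`, and the old branch set of `v` remains connected and adjacent to the branch sets of
the other labels. Its adjacency to the branch set of `j` is then automatic, through `v`. -/
theorem IsModel.update [DecidableEq V] {W : Type*} {H : SimpleGraph V} {f : V → W}
    (hf : IsModel H (completeGraph W) f) {v : V} {j : W} (hj : j ≠ f v)
    (hc : (H.induce ({u | f u = f v} \ {v})).Connected) (hw : ∃ w, H.Adj v w ∧ f w = j)
    (ht : ∀ k, k ≠ f v → k ≠ j → ∃ u w, H.Adj u w ∧ f u = f v ∧ u ≠ v ∧ f w = k) :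
    IsModel H (completeGraph W) (Function.update f v j) := by
  classical
  obtain ⟨w, hvw, hwj⟩ := hw
  have hsame : ∀ u, u ≠ v → Function.update f v j u = f u := fun u hu =>
    Function.update_of_ne hu _ _
  have hself : Function.update f v j v = j := Function.update_self _ _ _
  have hne : ∀ u, f u ≠ f v → u ≠ v := fun u hu h => hu (h ▸ rfl)
  constructor
  · intro i
    by_cases hij : i = j
    · subst hij
      have : {u | Function.update f v i u = i} = insert v {u | f u = i} := by
        ext u
        by_cases hu : u = v
        · simp [hu]
        · simp [hu]
      rw [this]
      exact connected_induce_insert (hf.branch_connected i) hwj hvw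
    · by_cases hiv : i = f v
      · have : {u | Function.update f v j u = i} = {u | f u = f v} \ {v} := by
          ext u
          by_cases hu : u = v
          · simp [hu, Ne.symm hij]
          · simp [hu, hiv]
        rw [this]
        exact hc
      · have : {u | Function.update f v j u = i} = {u | f u = i} := by
          ext u
          by_cases hu : u = v
          · simp [hu, Ne.symm hij, Ne.symm hiv]
          · simp [hu]
        rw [this]
        exact hf.branch_connected i
  · have hvj : ∃ u u', Function.update f v j u = f v ∧ Function.update f v j u' = j ∧
        H.Adj u u' := by
      obtain ⟨⟨u, hu, huv⟩⟩ := hc.nonempty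
      obtain ⟨u', hu', hne', e⟩ := exists_adj_of_connected_induce (hf.branch_connected (f v))
        (v := v) rfl hu huv
      exact ⟨u', v, (hsame _ hne').trans hu', hself, e.symm⟩
    have hvk : ∀ k, k ≠ f v → ∃ u u', Function.update f v j u = f v ∧
        Function.update f v j u' = k ∧ H.Adj u u' := by
      intro k hk
      by_cases hkj : k = j
      · exact hkj ▸ hvj
      · obtain ⟨u, u', e, hu, huv, hu'⟩ := ht k hk hkj
        exact ⟨u, u', (hsame _ huv).trans hu, (hsame _ (hne _ (hu' ▸ hk))).trans hu', e⟩
    intro i k hik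
    have hik' : i ≠ k := hik
    by_cases hiv : i = f v
    · subst hiv
      exact hvk k hik'.symm
    · by_cases hkv : k = f v
      · subst hkv
        obtain ⟨u, u', h1, h2, e⟩ := hvk i hik'
        exact ⟨u', u, h2, h1, e.symm⟩
      · obtain ⟨u, u', h1, h2, e⟩ := hf.exists_edge i k hik
        exact ⟨u, u', (hsame _ (hne _ (h1 ▸ hiv))).trans h1,
          (hsame _ (hne _ (h2 ▸ hkv))).trans h2, e⟩

/-- `ReachesModel G H f` says that some sequence of moves through `K₄`-models of `H` leads from `f`
to a `K₄`-model of `G`. It holds vacuously if `f` is not itself a model of `H`. -/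
def ReachesModel (G H : SimpleGraph V) (f : V → Fin 4) : Prop :=
  ∀ hf : IsModel H (completeGraph (Fin 4)) f, ∃ g, ∃ hg : IsModel H (completeGraph (Fin 4)) g,
    IsModel G (completeGraph (Fin 4)) g ∧
      (reconfigurationGraph H (completeGraph (Fin 4))).Reachable ⟨f, hf⟩ ⟨g, hg⟩

theorem ReachesModel.of_isModel {G H : SimpleGraph V} {f : V → Fin 4}
    (h : IsModel G (completeGraph (Fin 4)) f) : ReachesModel G H f :=
  fun hf => ⟨f, hf, h, Reachable.refl _⟩

theorem ReachesModel.of_update [DecidableEq V] {G H : SimpleGraph V} {f : V → Fin 4} {v : V}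
    {j : Fin 4} (hj : j ≠ f v) (hm : IsModel H (completeGraph (Fin 4)) (Function.update f v j))
    (h : ReachesModel G H (Function.update f v j)) : ReachesModel G H f := by
  intro hf
  obtain ⟨g, hg, hgG, hr⟩ := h hm
  refine ⟨g, hg, hgG, Reachable.trans (Adj.reachable ?_) hr⟩
  refine ⟨v, by simpa using hj.symm, fun u hu => ?_⟩
  by_contra hne
  exact hu (Function.update_of_ne hne _ _).symm

/-- Relabelling a vertex strictly shrinks its old branch set. -/
theorem ncard_update_lt [DecidableEq V] [Finite V] {W : Type*} {f : V → W} {v : V} {i j : W}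
    (hv : f v = i) (hj : j ≠ i) :
    {u | Function.update f v j u = i}.ncard < {u | f u = i}.ncard := by
  refine Set.ncard_lt_ncard ⟨fun u hu => ?_, fun h => ?_⟩ (Set.toFinite _)
  · by_cases huv : u = v
    · exact huv ▸ hv
    · simpa [huv] using hu
  · have : Function.update f v j v = i := h hv
    simp [hj] at this

theorem adj_sup_edge {G : SimpleGraph V} {x y : V} (hxy : x ≠ y) : (G ⊔ edge x y).Adj x y := by
  simp [edge_adj, hxy]

/-- The added edge disappears from any pair of vertices other than `x, y`. -/
theorem adj_of_adj_sup_edge {G : SimpleGraph V} {x y u w : V} (h : (G ⊔ edge x y).Adj u w)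
    (h1 : ¬ (u = x ∧ w = y)) (h2 : ¬ (u = y ∧ w = x)) : G.Adj u w := by
  rw [sup_adj, edge_adj] at h
  tauto

/-- A vertex set that does not contain both ends of the added edge is connected in `G` already. -/
theorem connected_induce_of_sup_edge {G : SimpleGraph V} {x y : V} {D : Set V}
    (h : ((G ⊔ edge x y).induce D).Connected) (hD : ¬ (x ∈ D ∧ y ∈ D)) :
    (G.induce D).Connected := by
  rw [connected_induce_iff_closed] at h ⊢
  refine ⟨h.1, fun S hS hne hcl => h.2 S hS hne fun s hs t ht e => hcl s hs t ht ?_⟩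
  exact adj_of_adj_sup_edge e (fun h => hD ⟨h.1 ▸ hS hs, h.2 ▸ ht⟩)
    (fun h => hD ⟨h.2 ▸ ht, h.1 ▸ hS hs⟩)

/-- A model whose branch sets at `x` and `y` are distinct and joined by an edge of `G` does not need
the added edge `xy`. -/
theorem IsModel.of_sup_edge {W : Type*} {G : SimpleGraph V} {x y : V} {f : V → W}
    (hf : IsModel (G ⊔ edge x y) (completeGraph W) f) (hxy : f x ≠ f y)
    (h : ∃ u w, G.Adj u w ∧ f u = f x ∧ f w = f y) : IsModel G (completeGraph W) f := by
  constructor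
  · intro i
    exact connected_induce_of_sup_edge (hf.branch_connected i) fun h => hxy (h.1.trans h.2.symm)
  · intro i j hij
    obtain ⟨p, q, e', hp, hq⟩ := h
    obtain ⟨u, w, hu, hw, e⟩ := hf.exists_edge i j hij
    by_cases h1 : u = x ∧ w = y
    · exact ⟨p, q, by rw [hp, ← h1.1, hu], by rw [hq, ← h1.2, hw], e'⟩
    · by_cases h2 : u = y ∧ w = x
      · exact ⟨q, p, by rw [hq, ← h2.1, hu], by rw [hp, ← h2.2, hw], e'.symm⟩
      · exact ⟨u, w, hu, hw, adj_of_adj_sup_edge e h1 h2⟩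

/-- Any two distinct labels extend to a list of all four. -/
theorem exists_other_labels (a b : Fin 4) (h : a ≠ b) : ∃ c d : Fin 4,
    c ≠ a ∧ c ≠ b ∧ d ≠ a ∧ d ≠ b ∧ c ≠ d ∧ ∀ k, k = a ∨ k = b ∨ k = c ∨ k = d := by
  revert a b
  decide

/-! ### Models separating the ends of the added edge -/

/-- Let the root `z` of a branch set of a `K₄`-model be adjacent to the branch set of `r`. If no
single vertex cuts a part of the branch set of `z` off from everything not labelled `r`, then this
branch set can lose a vertex other than `z` to a branch set other than that of `r`. -/
theorem exists_shrinking_move [Finite V] [DecidableEq V] {H : SimpleGraph V} {f : V → Fin 4}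
    (hf : IsModel H (completeGraph (Fin 4)) f) {z : V} {r : Fin 4} (hr : r ≠ f z)
    (hzr : ∃ w, H.Adj z w ∧ f w = r) (hne : ∃ u, f u = f z ∧ u ≠ z)
    (hsep : ∀ S ⊆ {u | f u = f z}, S.Nonempty → ∀ w, f w = f z → w ∉ S →
      ∃ s ∈ S, ∃ t, H.Adj s t ∧ t ∉ S ∧ t ≠ w ∧ f t ≠ r) :
    ∃ v, f v = f z ∧ v ≠ z ∧ ∃ k, k ≠ f z ∧ k ≠ r ∧
      IsModel H (completeGraph (Fin 4)) (Function.update f v k) := by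
  obtain ⟨v, hv, hvz, hconn, t, ⟨hti, htr⟩, hvt⟩ := exists_noncut_vertex
    (T := {t | f t ≠ f z ∧ f t ≠ r}) (hf.branch_connected (f z)) (z := z) rfl hne (by
      intro S hS hSne w hw hwS
      obtain ⟨s, hs, t, e, htS, htw, htr⟩ := hsep S hS hSne w hw hwS
      exact ⟨s, hs, t, e, htS, htw, (em (f t = f z)).imp id fun h => ⟨h, htr⟩⟩)
  replace hv : f v = f z := hv
  obtain ⟨w₀, hzw, hw₀⟩ := hzr
  -- Moving `v` to `k` leaves the branch set adjacent to that of `r` through `z`.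
  have move : ∀ k l, k ≠ f z → k ≠ r → (∀ m, m = f z ∨ m = r ∨ m = k ∨ m = l) →
      (∃ w, H.Adj v w ∧ f w = k) → (∃ u w, H.Adj u w ∧ f u = f z ∧ u ≠ v ∧ f w = l) →
      IsModel H (completeGraph (Fin 4)) (Function.update f v k) := by
    intro k l hk hkr hall hw hl
    refine hf.update (by rwa [hv]) (by rwa [hv]) hw fun m hm hmk => ?_
    rw [hv] at hm ⊢
    rcases hall m with h | h | h | h
    · exact (hm h).elim
    · exact ⟨z, w₀, hzw, rfl, hvz.symm, h ▸ hw₀⟩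
    · exact (hmk h).elim
    · exact h ▸ hl
  obtain ⟨q, hq, hqr, hqt, hall⟩ : ∃ q, q ≠ f z ∧ q ≠ r ∧ q ≠ f t ∧
      ∀ m, m = f z ∨ m = r ∨ m = f t ∨ m = q := by
    obtain ⟨c, d, h1, h2, h3, h4, h5, hall⟩ := exists_other_labels (f z) r hr.symm
    rcases hall (f t) with h | h | h | h
    · exact (hti h).elim
    · exact (htr h).elim
    · exact ⟨d, h3, h4, h ▸ h5.symm, fun m => by rw [h]; exact hall m⟩
    · exact ⟨c, h1, h2, h ▸ h5, fun m => by rw [h]; have := hall m; tauto⟩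
  by_cases hq' : ∃ u w, H.Adj u w ∧ f u = f z ∧ u ≠ v ∧ f w = q
  · exact ⟨v, hv, hvz, f t, hti, htr, move _ q hti htr hall ⟨t, hvt, rfl⟩ hq'⟩
  · -- Otherwise `v` is the only neighbour of the branch set of `q`, and can move there instead.
    refine ⟨v, hv, hvz, q, hq, hqr, move q (f t) hq hqr (fun m => ?_) ?_ ?_⟩
    · have := hall m; tauto
    · obtain ⟨u, w, hu, hw, e⟩ := hf.exists_edge (f z) q hq.symm
      by_cases huv : u = v
      · exact ⟨w, huv ▸ e, hw⟩
      · exact (hq' ⟨u, w, e, hu, huv, hw⟩).elim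
    · obtain ⟨s, ⟨hs, hsv⟩, t', e, ht', htv, htr'⟩ := hsep ({u | f u = f z} \ {v})
        Set.sdiff_subset ⟨z, rfl, hvz.symm⟩ v hv (fun h => h.2 rfl)
      refine ⟨s, t', e, hs, hsv, ?_⟩
      rcases hall (f t') with h | h | h | h
      · exact (ht' ⟨h, htv⟩).elim
      · exact (htr' h).elim
      · exact h
      · exact (hq' ⟨s, t', e, hs, hsv, h⟩).elim

/-- If `y` and some `z` are alone in their branch sets, the branch set of `x` can absorb the fourth
branch set vertex by vertex until it meets a neighbour of `y`. -/
theorem reachesModel_of_two_singletons [Finite V] {G : SimpleGraph V} (hG : IsKConnected G 4)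
    {x y z : V} (n : ℕ) : ∀ (f : V → Fin 4) (d : Fin 4), {u | f u = d}.ncard ≤ n → f x ≠ f y →
      (∀ u, f u = f y → u = y) → f z ≠ f x → f z ≠ f y → (∀ u, f u = f z → u = z) →
      d ≠ f x → d ≠ f y → d ≠ f z → ReachesModel G (G ⊔ edge x y) f := by
  classical
  induction n with
  | zero =>
    intro f d hn _ _ _ _ _ _ _ _ hf
    obtain ⟨⟨u, hu⟩⟩ := (hf.branch_connected d).nonempty
    have := (Set.ncard_pos (Set.toFinite {u | f u = d})).2 ⟨u, hu⟩
    omega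
  | succ n ih =>
    intro f d hn hxy hy hzx hzy hz hdx hdy hdz hf
    by_cases hA : ∃ u w, G.Adj u w ∧ f u = f x ∧ f w = f y
    · exact ReachesModel.of_isModel (hf.of_sup_edge hxy hA) hf
    have hall : ∀ k, k = f x ∨ k = f y ∨ k = f z ∨ k = d := by
      generalize f x = a at *
      generalize f y = b at *
      generalize f z = c at *
      clear hf hy hz hA hn ih
      revert a b c d
      decide
    have hcard : ∀ a b : V, ({a, b} : Finset V).card < 4 := fun a b =>
      Finset.card_le_two.trans_lt (by norm_num)
    have hxy' : x ≠ y := fun h => hxy (h ▸ rfl)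
    have hxz : x ≠ z := fun h => hzx (h ▸ rfl)
    have hyz : y ≠ z := fun h => hzy (h ▸ rfl)
    -- Since `y` has degree at least four, removing one vertex leaves it a neighbour labelled `d`.
    have hyd : ∀ v, f v = d → ∃ t, G.Adj y t ∧ f t = d ∧ t ≠ v := by
      intro v hv
      have hyv : y ≠ v := fun h => hdy (hv ▸ h ▸ rfl)
      have hxv : x ≠ v := fun h => hdx (hv ▸ h ▸ rfl)
      obtain ⟨s, hs, t, e, hty, htN⟩ := hG.exists_adj {v, z} (hcard _ _) (S := {y}) (x := x)
        (by simp [hyv, hyz]) ⟨y, rfl⟩ hxy' (by simp [hxv, hxz])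
      rw [Set.mem_singleton_iff] at hs
      subst hs
      simp only [Finset.mem_insert, Finset.mem_singleton, not_or] at htN
      refine ⟨t, e, ?_, htN.1⟩
      rcases hall (f t) with h | h | h | h
      · exact (hA ⟨t, s, e.symm, h, rfl⟩).elim
      · exact (hty (hy t h)).elim
      · exact (htN.2 (hz t h)).elim
      · exact h
    -- The root is a neighbour of `z`, so that the two branch sets remain adjacent.
    obtain ⟨z', d₀, hz', hd₀, hzd⟩ := hf.exists_edge (f z) d hdz.symm
    obtain rfl := hz z' hz'
    obtain ⟨t₀, -, ht₀, ht₀d⟩ := hyd d₀ hd₀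
    obtain ⟨v, hv, hvd, hconn, t, ht, hvt⟩ := exists_noncut_vertex (G := G ⊔ edge x y)
      (T := {t | f t = f x}) (hf.branch_connected d) hd₀ ⟨t₀, ht₀, ht₀d⟩ (by
        intro S hS hSne w hw hwS
        have hlab : ∀ s ∈ S, f s = d := hS
        obtain ⟨s, hs, t, e, htS, htN⟩ := hG.exists_adj {w, y, z'}
          (Finset.card_le_three.trans_lt (by norm_num)) (S := S) (x := x)
          (by
            intro s hs
            have h1 : s ≠ w := fun h => hwS (h ▸ hs)
            have h2 : s ≠ y := fun h => hdy (h ▸ (hlab s hs).symm)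
            have h3 : s ≠ z' := fun h => hdz (h ▸ (hlab s hs).symm)
            simp [h1, h2, h3])
          hSne (fun h => hdx (hlab x h).symm)
          (by
            have h1 : x ≠ w := fun h => hdx (hw.symm.trans (h ▸ rfl))
            simp [h1, hxy', hxz])
        simp only [Finset.mem_insert, Finset.mem_singleton, not_or] at htN
        refine ⟨s, hs, t, Or.inl e, htS, htN.1, ?_⟩
        rcases hall (f t) with h | h | h | h
        · exact Or.inr h
        · exact (htN.2.1 (hy t h)).elim
        · exact (htN.2.2 (hz t h)).elim
        · exact Or.inl h)
    replace hv : f v = d := hv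
    have hsame : ∀ u, f u ≠ d → Function.update f v (f x) u = f u := fun u hu =>
      Function.update_of_ne (fun h : u = v => hu (h ▸ hv)) _ _
    have hlab : ∀ u k, k ≠ f x → Function.update f v (f x) u = k → f u = k := by
      intro u k hk hu
      by_cases huv : u = v
      · subst huv
        rw [Function.update_self] at hu
        exact (hk hu.symm).elim
      · rwa [Function.update_of_ne huv] at hu
    have hm : IsModel (G ⊔ edge x y) (completeGraph (Fin 4)) (Function.update f v (f x)) := by
      refine hf.update (by rw [hv]; exact hdx.symm) (by rwa [hv]) ⟨t, hvt, ht⟩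
        fun k hk hkx => ?_
      rw [hv] at hk ⊢
      rcases hall k with h | h | h | h
      · exact (hkx h).elim
      · obtain ⟨u, e, hu, huv⟩ := hyd v hv
        exact ⟨u, y, Or.inl e.symm, hu, huv, h.symm⟩
      · exact ⟨d₀, z', hzd.symm, hd₀, hvd.symm, h.symm⟩
      · exact (hk h).elim
    refine ReachesModel.of_update (by rw [hv]; exact hdx.symm) hm (ih _ d ?_ ?_ ?_ ?_ ?_ ?_ ?_ ?_ ?_)
      hf
    · have := ncard_update_lt hv hdx.symm
      omega
    all_goals simp only [hsame x hdx.symm, hsame y hdy.symm, hsame z' hdz.symm]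
    · exact hxy
    · exact fun u hu => hy u (hlab u _ hxy.symm hu)
    · exact hzx
    · exact hzy
    · exact fun u hu => hz u (hlab u _ hzx hu)
    · exact hdx
    · exact hdy
    · exact hdz

/-- If `y` is alone in its branch set, another branch set can be shrunk to a single vertex. -/
theorem reachesModel_of_singleton [Finite V] {G : SimpleGraph V} (hG : IsKConnected G 4)
    {x y : V} (n : ℕ) : ∀ (f : V → Fin 4) (c : Fin 4), {u | f u = c}.ncard ≤ n → f x ≠ f y →
      (∀ u, f u = f y → u = y) → c ≠ f x → c ≠ f y → ReachesModel G (G ⊔ edge x y) f := by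
  classical
  induction n with
  | zero =>
    intro f c hn _ _ _ _ hf
    obtain ⟨⟨u, hu⟩⟩ := (hf.branch_connected c).nonempty
    have := (Set.ncard_pos (Set.toFinite {u | f u = c})).2 ⟨u, hu⟩
    omega
  | succ n ih =>
    intro f c hn hxy hy hcx hcy hf
    obtain ⟨z, w₀, rfl, hw₀, hzw⟩ := hf.exists_edge c (f y) hcy
    by_cases hz : ∀ u, f u = f z → u = z
    · obtain ⟨d, d', h1, h2, h3, h4, h5, hall⟩ := exists_other_labels (f x) (f y) hxy
      rcases hall (f z) with h | h | h | h
      · exact (hcx h).elim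
      · exact (hcy h).elim
      · exact reachesModel_of_two_singletons hG _ f d' le_rfl hxy hy hcx hcy hz h3 h4
          (h ▸ h5.symm) hf
      · exact reachesModel_of_two_singletons hG _ f d le_rfl hxy hy hcx hcy hz h1 h2
          (h ▸ h5) hf
    push Not at hz
    obtain ⟨v, hv, -, k, hk, hky, hm⟩ := exists_shrinking_move hf hcy.symm ⟨w₀, hzw, hw₀⟩ hz (by
      intro S hS hSne w hw hwS
      have hlab : ∀ s ∈ S, f s = f z := hS
      obtain ⟨s, hs, t, e, htS, htN⟩ := hG.exists_adj {w, y}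
        (Finset.card_le_two.trans_lt (by norm_num)) (S := S) (x := x)
        (by
          intro s hs
          have h1 : s ≠ w := fun h => hwS (h ▸ hs)
          have h2 : s ≠ y := fun h => hcy (h ▸ (hlab s hs).symm)
          simp [h1, h2])
        hSne (fun h => hcx (hlab x h).symm)
        (by
          have h1 : x ≠ w := fun h => hcx (hw.symm.trans (h ▸ rfl))
          have h2 : x ≠ y := fun h => hxy (h ▸ rfl)
          simp [h1, h2])
      simp only [Finset.mem_insert, Finset.mem_singleton, not_or] at htN
      exact ⟨s, hs, t, Or.inl e, htS, htN.1, fun h => htN.2 (hy t h)⟩)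
    have hsame : ∀ u, f u ≠ f z → Function.update f v k u = f u := fun u hu =>
      Function.update_of_ne (fun h : u = v => hu (h ▸ hv)) _ _
    refine ReachesModel.of_update (by rwa [hv]) hm (ih _ (f z) ?_ ?_ ?_ ?_ ?_) hf
    · have := ncard_update_lt hv hk
      omega
    all_goals simp only [hsame x hcx.symm, hsame y hcy.symm]
    · exact hxy
    · intro u hu
      by_cases huv : u = v
      · rw [huv, Function.update_self] at hu
        exact (hky hu).elim
      · rw [Function.update_of_ne huv] at hu
        exact hy u hu
    · exact hcx
    · exact hcy

/-- If `x` and `y` have different labels, the branch set of `y` can be shrunk to `y` alone, unless an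
edge of `G` joins the branch sets of `x` and `y` already. -/
theorem reachesModel_of_label_ne [Finite V] {G : SimpleGraph V} (hG : IsKConnected G 4)
    {x y : V} (n : ℕ) : ∀ f : V → Fin 4, {u | f u = f y}.ncard ≤ n → f x ≠ f y →
      ReachesModel G (G ⊔ edge x y) f := by
  classical
  induction n with
  | zero =>
    intro f hn _ hf
    have := (Set.ncard_pos (Set.toFinite {u | f u = f y})).2 ⟨y, rfl⟩
    omega
  | succ n ih =>
    intro f hn hxy hf
    by_cases hA : ∃ u w, G.Adj u w ∧ f u = f x ∧ f w = f y
    · exact ReachesModel.of_isModel (hf.of_sup_edge hxy hA) hf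
    by_cases hy : ∀ u, f u = f y → u = y
    · obtain ⟨c, -, h1, h2, -⟩ := exists_other_labels (f x) (f y) hxy
      exact reachesModel_of_singleton hG _ f c le_rfl hxy hy h1 h2 hf
    push Not at hy
    have hxy' : x ≠ y := fun h => hxy (h ▸ rfl)
    obtain ⟨v, hv, hvy, k, hk, -, hm⟩ := exists_shrinking_move hf hxy
      ⟨x, (adj_sup_edge hxy').symm, rfl⟩ hy (by
      intro S hS hSne w hw hwS
      have hlab : ∀ s ∈ S, f s = f y := hS
      obtain ⟨s, hs, t, e, htS, htN⟩ := hG.exists_adj {w} (by simp) (S := S) (x := x)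
        (by
          intro s hs
          have h1 : s ≠ w := fun h => hwS (h ▸ hs)
          simp [h1])
        hSne (fun h => hxy (hlab x h))
        (by
          have h1 : x ≠ w := fun h => hxy (h ▸ hw)
          simp [h1])
      exact ⟨s, hs, t, Or.inl e, htS, by simpa using htN,
        fun h => hA ⟨t, s, e.symm, h, hlab s hs⟩⟩)
    have hx' : Function.update f v k x = f x :=
      Function.update_of_ne (fun h : x = v => hxy (h ▸ hv)) _ _
    have hy' : Function.update f v k y = f y := Function.update_of_ne hvy.symm _ _
    refine ReachesModel.of_update (by rwa [hv]) hm (ih _ ?_ ?_) hf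
    · rw [hy']
      have := ncard_update_lt hv hk
      omega
    · rwa [hx', hy']

/-! ### Models in which the added edge is a bridge of a branch set -/

/-- Suppose that `xy` joins two parts `A₁ ∋ x` and `A₂ ∋ y` of one branch set that are connected in
`G`, with no edge of `G` between them. If `A₁` has `G`-neighbours in two of the other branch sets,
then `A₂` can be handed over to the other branch sets vertex by vertex, `y` last. -/
theorem reachesModel_of_bridge [Finite V] {G : SimpleGraph V} (hG : IsKConnected G 4)
    {x y : V} (hxy : x ≠ y) {A₁ : Set V} (hx : x ∈ A₁) (hA₁ : (G.induce A₁).Connected)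
    {a b c : Fin 4} (hba : b ≠ a) (hca : c ≠ a) (hbc : b ≠ c) (n : ℕ) :
    ∀ (f : V → Fin 4) (A₂ : Set V), A₂.ncard ≤ n → y ∈ A₂ → (G.induce A₂).Connected →
      Disjoint A₁ A₂ → {u | f u = a} = A₁ ∪ A₂ → (∀ u ∈ A₁, ∀ w ∈ A₂, ¬ G.Adj u w) →
      (∃ u ∈ A₁, ∃ w, G.Adj u w ∧ f w = b) → (∃ u ∈ A₁, ∃ w, G.Adj u w ∧ f w = c) →
      ReachesModel G (G ⊔ edge x y) f := by
  classical
  obtain ⟨d, hda, hdb, hdc, hall⟩ : ∃ d : Fin 4, d ≠ a ∧ d ≠ b ∧ d ≠ c ∧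
      ∀ k, k = a ∨ k = b ∨ k = c ∨ k = d := by
    revert a b c
    decide
  induction n with
  | zero =>
    intro f A₂ hn hy
    have := (Set.ncard_pos (Set.toFinite A₂)).2 ⟨y, hy⟩
    omega
  | succ n ih =>
    intro f A₂ hn hy hA₂ hdisj hpart hno hb hc hf
    have hlab₁ : ∀ u ∈ A₁, f u = a := fun u hu => (hpart.symm ▸ Or.inl hu : u ∈ {u | f u = a})
    have hlab₂ : ∀ u ∈ A₂, f u = a := fun u hu => (hpart.symm ▸ Or.inr hu : u ∈ {u | f u = a})
    have hmem : ∀ u, f u = a → u ∈ A₁ ∨ u ∈ A₂ := fun u hu => (hpart ▸ hu : u ∈ A₁ ∪ A₂)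
    have hnot : ∀ u ∈ A₁, u ∉ A₂ := fun u h1 h2 => Set.disjoint_left.1 hdisj h1 h2
    have hfx := hlab₁ x hx
    -- An edge of `H` from this branch set to another one is an edge of `G`.
    have hGadj : ∀ u w, (G ⊔ edge x y).Adj u w → f w ≠ a → G.Adj u w := fun u w e hw =>
      adj_of_adj_sup_edge e (fun h => hw (h.2 ▸ hlab₂ y hy)) (fun h => hw (h.2 ▸ hfx))
    -- By 2-connectivity, no vertex cuts a part of `A₂` off from the rest of the graph.
    have hsep : ∀ S ⊆ A₂, S.Nonempty → ∀ N : Finset V, N.card < 4 → (∀ s ∈ S, s ∉ N) → x ∉ N →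
        ∃ s ∈ S, ∃ t, G.Adj s t ∧ t ∉ S ∧ t ∉ N ∧ (t ∈ A₂ ∨ f t ≠ a) := by
      intro S hS hSne N hN hSN hxN
      obtain ⟨s, hs, t, e, htS, htN⟩ := hG.exists_adj N hN hSN hSne
        (fun h => hnot x hx (hS h)) hxN
      refine ⟨s, hs, t, e, htS, htN, ?_⟩
      by_cases hta : f t = a
      · exact Or.inl ((hmem t hta).resolve_left fun h => hno t h s (hS hs) e.symm)
      · exact Or.inr hta
    -- How `A₁` remains adjacent to the other branch sets after a move of a vertex `v` of `A₂`.
    have hadj : ∀ v ∈ A₂, ∀ k, (k = d → ∃ u w, G.Adj u w ∧ f u = a ∧ u ≠ v ∧ f w = d) → k ≠ a →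
        ∃ u w, (G ⊔ edge x y).Adj u w ∧ f u = a ∧ u ≠ v ∧ f w = k := by
      intro v hv k hkd hka
      rcases hall k with h | h | h | h
      · exact (hka h).elim
      · obtain ⟨u, hu, w, e, hw⟩ := hb
        exact ⟨u, w, Or.inl e, hlab₁ u hu, fun h' => hnot u hu (h' ▸ hv), h ▸ hw⟩
      · obtain ⟨u, hu, w, e, hw⟩ := hc
        exact ⟨u, w, Or.inl e, hlab₁ u hu, fun h' => hnot u hu (h' ▸ hv), h ▸ hw⟩
      · obtain ⟨u, w, e, hu, huv, hw⟩ := hkd h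
        exact ⟨u, w, Or.inl e, hu, huv, h ▸ hw⟩
    -- The label to which `v` moves: `d` if possible, as only the label `d` may be lost.
    have htarget : ∀ v ∈ A₂, (∃ t, G.Adj v t ∧ f t ≠ a) → ∃ k, k ≠ a ∧
        (∃ w, (G ⊔ edge x y).Adj v w ∧ f w = k) ∧
        ∀ m, m ≠ a → m ≠ k → ∃ u w, (G ⊔ edge x y).Adj u w ∧ f u = a ∧ u ≠ v ∧ f w = m := by
      rintro v hv ⟨t, hvt, hta⟩
      by_cases hvd : ∃ w, G.Adj v w ∧ f w = d
      · obtain ⟨w, e, hw⟩ := hvd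
        exact ⟨d, hda, ⟨w, Or.inl e, hw⟩, fun m hma hmd =>
          hadj v hv m (fun h => (hmd h).elim) hma⟩
      · refine ⟨f t, hta, ⟨t, Or.inl hvt, rfl⟩, fun m hma _ => hadj v hv m (fun _ => ?_) hma⟩
        obtain ⟨u, w, hu, hw, e⟩ := hf.exists_edge a d hda.symm
        have e' := hGadj u w e (hw.trans_ne hda)
        exact ⟨u, w, e', hu, fun h => hvd ⟨w, h ▸ e', hw⟩, hw⟩
    by_cases hone : ∃ u ∈ A₂, u ≠ y
    · obtain ⟨v, hv, hvy, hconn, t, ht, hvt⟩ := exists_noncut_vertex (T := {t | f t ≠ a})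
        hA₂ hy hone (by
          intro S hS hSne w hw hwS
          obtain ⟨s, hs, t, e, htS, htw, h⟩ := hsep S hS hSne {w} (by simp)
            (fun s hs => by
              have : s ≠ w := fun h => hwS (h ▸ hs)
              simpa using this)
            (by
              have : x ≠ w := fun h => hnot x hx (h ▸ hw)
              simpa using this)
          exact ⟨s, hs, t, e, htS, by simpa using htw, h⟩)
      have hfv := hlab₂ v hv
      obtain ⟨k, hka, hw, hk⟩ := htarget v hv ⟨t, hvt, ht⟩
      have hset : (A₁ ∪ A₂) \ {v} = A₁ ∪ (A₂ \ {v}) := by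
        ext u
        have : u ∈ A₁ → u ≠ v := fun hu h => hnot u hu (h ▸ hv)
        simp only [Set.mem_sdiff, Set.mem_union, Set.mem_singleton_iff]
        tauto
      have hm : IsModel (G ⊔ edge x y) (completeGraph (Fin 4)) (Function.update f v k) := by
        refine hf.update (by rwa [hfv]) ?_ hw (by rwa [hfv])
        rw [hfv, hpart, hset]
        exact connected_induce_union (hA₁.mono fun _ _ e => Or.inl e)
          (hconn.mono fun _ _ e => Or.inl e) hx ⟨hy, hvy.symm⟩ (adj_sup_edge hxy)
      have hkeep : ∀ w, f w ≠ a → Function.update f v k w = f w := fun w hw =>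
        Function.update_of_ne (fun h : w = v => hw (h ▸ hfv)) _ _
      refine ReachesModel.of_update (by rwa [hfv]) hm (ih _ (A₂ \ {v}) ?_ ⟨hy, hvy.symm⟩ hconn
        (hdisj.mono_right Set.sdiff_subset) ?_ (fun u hu w hw => hno u hu w hw.1) ?_ ?_) hf
      · have := Set.ncard_sdiff_singleton_lt_of_mem hv (Set.toFinite A₂)
        omega
      · rw [← hset, ← hpart]
        ext u
        by_cases huv : u = v
        · simp [huv, hka]
        · simp [huv]
      · obtain ⟨u, hu, w, e, hw⟩ := hb
        exact ⟨u, hu, w, e, (hkeep w (hw.trans_ne hba)).trans hw⟩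
      · obtain ⟨u, hu, w, e, hw⟩ := hc
        exact ⟨u, hu, w, e, (hkeep w (hw.trans_ne hca)).trans hw⟩
    · push Not at hone
      obtain rfl : A₂ = {y} := Set.eq_singleton_iff_unique_mem.2 ⟨hy, hone⟩
      have hfy := hlab₂ y hy
      obtain ⟨s, hs, t, e, htS, -, ht⟩ := hsep {y} subset_rfl ⟨y, rfl⟩ ∅ (by simp) (by simp)
        (by simp)
      rw [Set.mem_singleton_iff] at hs
      subst hs
      obtain ⟨k, hka, hw, hk⟩ := htarget s hy ⟨t, e, ht.resolve_left htS⟩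
      have hset : (A₁ ∪ {s}) \ {s} = A₁ := by
        ext u
        have : u ∈ A₁ → u ≠ s := fun hu h => hnot u hu h
        simp only [Set.mem_sdiff, Set.mem_union, Set.mem_singleton_iff]
        tauto
      have hm : IsModel (G ⊔ edge x s) (completeGraph (Fin 4)) (Function.update f s k) := by
        refine hf.update (by rwa [hfy]) ?_ hw (by rwa [hfy])
        rw [hfy, hpart, hset]
        exact hA₁.mono fun _ _ e => Or.inl e
      refine ReachesModel.of_update (by rwa [hfy]) hm
        (reachesModel_of_label_ne hG _ _ le_rfl ?_) hf
      rw [Function.update_of_ne hxy, Function.update_self, hfx]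
      exact hka.symm

/-- Deleting the edge `xy` from a connected set leaves the side of `x` connected. -/
theorem connected_induce_side {G : SimpleGraph V} {x y : V} {D A : Set V}
    (hD : ((G ⊔ edge x y).induce D).Connected) (hA : A ⊆ D) (hx : x ∈ A) (hy : y ∉ A)
    (hcl : ∀ u ∈ A, ∀ w ∈ D, G.Adj u w → w ∈ A) : (G.induce A).Connected := by
  rw [connected_induce_iff_closed] at hD ⊢
  -- A `G`-closed part of `A` avoiding `x` is closed in `D` even with the edge `xy` added.
  have key : ∀ S ⊆ A, S.Nonempty → x ∉ S → (∀ s ∈ S, ∀ t ∈ A, G.Adj s t → t ∈ S) → False := by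
    intro S hS hne hxS hScl
    refine hxS (hD.2 S (hS.trans hA) hne (fun s hs t ht e => ?_) (hA hx))
    have e' := adj_of_adj_sup_edge e (fun h => hxS (h.1 ▸ hs)) (fun h => hy (h.1 ▸ hS hs))
    exact hScl s hs t (hcl s (hS hs) t ht e') e'
  refine ⟨⟨x, hx⟩, fun S hS hne hScl => ?_⟩
  by_cases hxS : x ∈ S
  · intro u hu
    by_contra huS
    exact key (A \ S) Set.sdiff_subset ⟨u, hu, huS⟩ (fun h => h.2 hxS)
      fun s hs t ht e => ⟨ht, fun htS => hs.2 (hScl t htS s hs.1 e.symm)⟩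
  · exact (key S hS hne hxS hScl).elim

/-- Every `K₄`-model of `G + xy` can be moved to a `K₄`-model of `G`. -/
theorem reachesModel [Finite V] {G : SimpleGraph V} (hG : IsKConnected G 4)
    {x y : V} (hxy : x ≠ y) (f : V → Fin 4) : ReachesModel G (G ⊔ edge x y) f := by
  classical
  by_cases hlab : f x ≠ f y
  · exact reachesModel_of_label_ne hG _ f le_rfl hlab
  push Not at hlab
  intro hf
  have hGadj : ∀ u w, (G ⊔ edge x y).Adj u w → f u ≠ f w → G.Adj u w := fun u w e hne =>
    adj_of_adj_sup_edge e (fun h => hne (by rw [h.1, h.2, hlab]))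
      (fun h => hne (by rw [h.1, h.2, hlab]))
  have hD := hf.branch_connected (f x)
  by_cases hconn : (G.induce {u | f u = f x}).Connected
  · refine ReachesModel.of_isModel ⟨fun i => ?_, fun i j hij => ?_⟩ hf
    · by_cases hi : f x = i
      · exact hi ▸ hconn
      · exact connected_induce_of_sup_edge (hf.branch_connected i) fun h => hi h.1
    · obtain ⟨u, w, hu, hw, e⟩ := hf.exists_edge i j hij
      exact ⟨u, w, hu, hw, hGadj u w e (by rw [hu, hw]; exact hij)⟩
  -- The branch set of `x` and `y` falls into two sides in `G`.
  obtain ⟨A, hAD, hxA, hyA, hcl⟩ : ∃ A ⊆ {u | f u = f x}, x ∈ A ∧ y ∉ A ∧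
      ∀ u ∈ A, ∀ w ∈ {u | f u = f x}, G.Adj u w → w ∈ A := by
    rw [connected_induce_iff_closed] at hconn hD
    push Not at hconn
    obtain ⟨S, hS, hne, hScl, hnot⟩ := hconn ⟨x, rfl⟩
    have hsplit : ¬ (x ∈ S ↔ y ∈ S) := by
      intro hiff
      refine hnot (hD.2 S hS hne fun s hs t ht e => ?_)
      by_cases h1 : s = x ∧ t = y
      · rw [h1.2]
        exact hiff.1 (h1.1 ▸ hs)
      · by_cases h2 : s = y ∧ t = x
        · rw [h2.2]
          exact hiff.2 (h2.1 ▸ hs)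
        · exact hScl s hs t ht (adj_of_adj_sup_edge e h1 h2)
    by_cases hxS : x ∈ S
    · exact ⟨S, hS, hxS, fun h => hsplit (by tauto), hScl⟩
    · exact ⟨{u | f u = f x} \ S, Set.sdiff_subset, ⟨rfl, hxS⟩,
        fun h => hsplit (by have := h.2; tauto), fun u hu w hw e =>
          ⟨hw, fun hwS => hu.2 (hScl w hwS u hu.1 e.symm)⟩⟩
  have hcl' : ∀ u ∈ {u | f u = f x} \ A, ∀ w ∈ {u | f u = f x}, G.Adj u w →
      w ∈ {u | f u = f x} \ A := fun u hu w hw e => ⟨hw, fun h => hu.2 (hcl w h u hu.1 e.symm)⟩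
  have hyD : y ∈ {u | f u = f x} \ A := ⟨hlab.symm, hyA⟩
  have hA₁ := connected_induce_side hD hAD hxA hyA hcl
  have hA₂ : (G.induce ({u | f u = f x} \ A)).Connected :=
    connected_induce_side (x := y) (y := x) (by rwa [edge_comm]) Set.sdiff_subset hyD
      (fun h => h.2 hxA) hcl'
  have hno : ∀ u ∈ A, ∀ w ∈ {u | f u = f x} \ A, ¬ G.Adj u w := fun u hu w hw e =>
    hw.2 (hcl u hu w hw.1 e)
  -- Each of the three other branch sets is adjacent to one of the sides.
  have htouch : ∀ k, k ≠ f x → (∃ u ∈ A, ∃ w, G.Adj u w ∧ f w = k) ∨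
      ∃ u ∈ {u | f u = f x} \ A, ∃ w, G.Adj u w ∧ f w = k := by
    intro k hk
    obtain ⟨u, w, hu, hw, e⟩ := hf.exists_edge (f x) k hk.symm
    have e' := hGadj u w e (by rw [hu, hw]; exact hk.symm)
    by_cases huA : u ∈ A
    · exact Or.inl ⟨u, huA, w, e', hw⟩
    · exact Or.inr ⟨u, ⟨hu, huA⟩, w, e', hw⟩
  have huse₁ : ∀ b c, b ≠ f x → c ≠ f x → b ≠ c → (∃ u ∈ A, ∃ w, G.Adj u w ∧ f w = b) →
      (∃ u ∈ A, ∃ w, G.Adj u w ∧ f w = c) → ReachesModel G (G ⊔ edge x y) f :=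
    fun b c hb hc hbc h1 h2 => reachesModel_of_bridge hG hxy hxA hA₁ hb hc hbc _ f _ le_rfl hyD
      hA₂ Set.disjoint_sdiff_right (Set.union_sdiff_cancel hAD).symm hno h1 h2
  have huse₂ : ∀ b c, b ≠ f x → c ≠ f x → b ≠ c →
      (∃ u ∈ {u | f u = f x} \ A, ∃ w, G.Adj u w ∧ f w = b) →
      (∃ u ∈ {u | f u = f x} \ A, ∃ w, G.Adj u w ∧ f w = c) →
      ReachesModel G (G ⊔ edge x y) f := by
    intro b c hb hc hbc h1 h2
    rw [edge_comm]
    exact reachesModel_of_bridge hG hxy.symm hyD hA₂ hb hc hbc _ f A le_rfl hxA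
      hA₁ Set.disjoint_sdiff_left (Set.sdiff_union_of_subset hAD).symm
      (fun u hu w hw e => hno w hw u hu e.symm) h1 h2
  obtain ⟨b, hb⟩ : ∃ b, b ≠ f x := exists_ne _
  obtain ⟨c, d, hca, hcb, hda, hdb, hcd, -⟩ := exists_other_labels (f x) b hb.symm
  -- By pigeonhole, one of the sides is adjacent to two of them.
  rcases htouch b hb with h1 | h1 <;> rcases htouch c hca with h2 | h2 <;>
    rcases htouch d hda with h3 | h3
  · exact huse₁ b c hb hca hcb.symm h1 h2 hf
  · exact huse₁ b c hb hca hcb.symm h1 h2 hf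
  · exact huse₁ b d hb hda hdb.symm h1 h3 hf
  · exact huse₂ c d hca hda hcd h2 h3 hf
  · exact huse₁ c d hca hda hcd h2 h3 hf
  · exact huse₂ b d hb hda hdb.symm h1 h3 hf
  · exact huse₂ b c hb hca hcb.symm h1 h2 hf
  · exact huse₂ b c hb hca hcb.symm h1 h2 hf

end MinorReconfiguration

theorem mainTheorem7 {V : Type*} [Finite V] (G : SimpleGraph V)
    (hconn : MinorReconfiguration.IsKConnected G 4)
    (hhost : G ∈ MinorReconfiguration.host (SimpleGraph.completeGraph (Fin 4)) V)
    (x y : V) (hxy : x ≠ y) :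
    G ⊔ SimpleGraph.edge x y ∈ MinorReconfiguration.host (SimpleGraph.completeGraph (Fin 4)) V := by
  open MinorReconfiguration in
  have hG : (reconfigurationGraph G (SimpleGraph.completeGraph (Fin 4))).Connected := hhost
  -- The reconfiguration graph of `G` is a subgraph of that of `G + xy`.
  let φ : reconfigurationGraph G (SimpleGraph.completeGraph (Fin 4)) →g
      reconfigurationGraph (G ⊔ SimpleGraph.edge x y) (SimpleGraph.completeGraph (Fin 4)) :=
    ⟨fun f => ⟨f.1, f.2.mono le_sup_left⟩, fun h => h⟩
  have : Nonempty {f : V → Fin 4 //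
      IsModel (G ⊔ SimpleGraph.edge x y) (SimpleGraph.completeGraph (Fin 4)) f} :=
    hG.nonempty.map φ
  refine SimpleGraph.Connected.mk fun f g => ?_
  obtain ⟨f', _, hf', hff'⟩ := reachesModel hconn hxy f.1 f.2
  obtain ⟨g', _, hg', hgg'⟩ := reachesModel hconn hxy g.1 g.2
  exact hff'.trans (((hG.preconnected ⟨f', hf'⟩ ⟨g', hg'⟩).map φ).trans hgg'.symm)
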